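/- Let $\Omega\subseteq\mathbb R^d$ be any set and let $C(\Omega)$ be the set of continuous real functions on $\Omega$, with the pointwise order and operations. An interval function on $\Omega$ is a map $f=[\underline f,\overline f]$ from $\Omega$ to the compact intervals $[a,b]$ with $a\le b$ real; it is locally bounded if every $x\in\Omega$ has a relative ball $B_\delta(x)=\{y\in\Omega:\|x-y\|<\delta\}$ and an $M\in\mathbb R$ with $\max\{|\underline f(y)|,|\overline f(y)|\}<M$ for all $y\in B_\delta(x)$. For locally bounded $g$ put $$F(g)(x)=\Big[\sup_{\delta>0}\ \inf_{y\in B_\delta(x)}\underline g(y),\ \ \inf_{\delta>0}\ \sup_{y\in B_\delta(x)}\overline g(y)\Big],\qquad x\in\Omega .$$ A locally bounded interval function $f$ is Hausdorff continuous if $F(g)=f$ for every locally bounded interval function $g$ with $g(x)\subseteq f(x)$ for all $x\in\Omega$. Let $\mathbb H(\Omega)$ be the set of Hausdorff continuous interval functions, partially ordered by $f\le g$ iff $\underline f(x)\le\underline g(x)$ and $\overline f(x)\le\overline g(x)$ for all $x\in\Omega$; $C(\Omega)$ is regarded as a subset of $\mathbb H(\Omega)$ via $u\mapsto[u,u]$.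 A sequence $(\xi_n)$ in a partially ordered set $P$ order converges to $\xi\in P$ if there are an increasing sequence $(\alpha_n)$ and a decreasing sequence $(\beta_n)$ in $P$ with $\alpha_n\le\xi_n\le\beta_n$ for all $n$ and $\xi=\sup_n\alpha_n=\inf_n\beta_n$. A sequence $(u_n)$ in $C(\Omega)$ is Cauchy if there is a decreasing sequence $(\beta_n)$ in $C(\Omega)$ whose infimum in $C(\Omega)$ is $0$ and such that $u_m-u_k\le\beta_n$ whenever $m,k\ge n$. Let $f,g\in\mathbb H(\Omega)$. 1. If $(f_n)$ and $(g_n)$ are Cauchy sequences in $C(\Omega)$ that order converge in $\mathbb H(\Omega)$ to $f$ and $g$ respectively, then $(f_n+g_n)$ and $(f_n g_n)$ each order converge in $\mathbb H(\Omega)$, each to exactly one limit. 2. These limits depend only on $f$ and $g$: if $(f^{(i)}_n)$ and $(g^{(i)}_n)$, $i=1,2$, are Cauchy sequences in $C(\Omega)$ that order converge in $\mathbb H(\Omega)$ to $f$ and $g$ respectively, then $(f^{(1)}_n+g^{(1)}_n)$ and $(f^{(2)}_n+g^{(2)}_n)$ have the same order limit, and $(f^{(1)}_n g^{(1)}_n)$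 and $(f^{(2)}_n g^{(2)}_n)$ have the same order limit. -/

import Mathlib

namespace HausdorffContinuous

/-- The modulus `|[a, b]| = max {|a|, |b|}` of a compact real interval. -/
noncomputable def modulus (a : NonemptyInterval ℝ) : ℝ := max |a.fst| |a.snd|

section

variable {X : Type*} [PseudoMetricSpace X]

/-- Locally bounded interval-valued functions. -/
def LocallyBounded (f : X → NonemptyInterval ℝ) : Prop :=
  ∀ x, ∃ δ > 0, ∃ M : ℝ, ∀ y ∈ Metric.ball x δ, modulus (f y) < M

/-- The lower Baire operator `I(f)(x) = sup_{δ > 0} inf {f(y) : y ∈ B_δ(x)}`. It is computed in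
the extended reals, since the infimum over a large ball may be `-∞`. -/
noncomputable def lowerBaire (f : X → NonemptyInterval ℝ) (x : X) : EReal :=
  ⨆ δ : ℝ, ⨆ _ : 0 < δ, ⨅ y ∈ Metric.ball x δ, ((f y).fst : EReal)

/-- The upper Baire operator `S(f)(x) = inf_{δ > 0} sup {f(y) : y ∈ B_δ(x)}`. It is computed in
the extended reals, since the supremum over a large ball may be `+∞`. -/
noncomputable def upperBaire (f : X → NonemptyInterval ℝ) (x : X) : EReal :=
  ⨅ δ : ℝ, ⨅ _ : 0 < δ, ⨆ y ∈ Metric.ball x δ, ((f y).snd : EReal)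

/-- `F(g) = f`: the graph completion `F(g)(x) = [I(g)(x), S(g)(x)]` of `g` is `f`. -/
def GraphCompletionEq (g f : X → NonemptyInterval ℝ) : Prop :=
  ∀ x, lowerBaire g x = ((f x).fst : EReal) ∧ upperBaire g x = ((f x).snd : EReal)

/-- Hausdorff continuity of an interval-valued function: `f` is locally bounded, and every locally
bounded `g` with `g(x) ⊆ f(x)` for all `x` satisfies `F(g) = f`. -/
def IsHContinuous (f : X → NonemptyInterval ℝ) : Prop :=
  LocallyBounded f ∧
    ∀ g : X → NonemptyInterval ℝ, LocallyBounded g →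
      (∀ x, (g x : Set ℝ) ⊆ (f x : Set ℝ)) → GraphCompletionEq g f

end

/-- The set `ℍ(X)` of all Hausdorff continuous interval functions on `X`. -/
structure HFun (X : Type*) [PseudoMetricSpace X] where
  toFun : X → NonemptyInterval ℝ
  isHContinuous : IsHContinuous toFun

/-- The order on `ℍ(X)`: pointwise, with `[a, b] ≤ [c, d]` iff `a ≤ c` and `b ≤ d`
(not the inclusion order that Mathlib puts on intervals). -/
instance {X : Type*} [PseudoMetricSpace X] : PartialOrder (HFun X) where
  le f g := ∀ x, (f.toFun x).fst ≤ (g.toFun x).fst ∧ (f.toFun x).snd ≤ (g.toFun x).snd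
  le_refl _ _ := ⟨le_rfl, le_rfl⟩
  le_trans _ _ _ h₁ h₂ x := ⟨(h₁ x).1.trans (h₂ x).1, (h₁ x).2.trans (h₂ x).2⟩
  le_antisymm f g h₁ h₂ := by
    obtain ⟨f, hf⟩ := f
    obtain ⟨g, hg⟩ := g
    have : f = g := funext fun x => NonemptyInterval.ext
      (Prod.ext ((h₁ x).1.antisymm (h₂ x).1) ((h₁ x).2.antisymm (h₂ x).2))
    subst this
    rfl

/-- A continuous real function, seen as a function with point-interval values, is Hausdorff
continuous. -/
theorem isHContinuous_pure {X : Type*} [PseudoMetricSpace X] (u : C(X, ℝ)) :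
    IsHContinuous fun x => NonemptyInterval.pure (u x) := by
  have key : ∀ x, ∀ ε > 0, ∃ δ > 0, ∀ y ∈ Metric.ball x δ, |u y - u x| < ε := by
    intro x ε hε
    obtain ⟨δ, hδ, h⟩ := Metric.continuous_iff.1 u.continuous x ε hε
    exact ⟨δ, hδ, fun y hy => by simpa [Real.dist_eq] using h y hy⟩
  refine ⟨fun x => ?_, fun g _ hg => ?_⟩
  · obtain ⟨δ, hδ, h⟩ := key x 1 one_pos
    refine ⟨δ, hδ, |u x| + 1, fun y hy => ?_⟩
    have h1 := h y hy
    have h2 := abs_sub_abs_le_abs_sub (u y) (u x)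
    change max |u y| |u y| < |u x| + 1
    rw [max_self]
    linarith
  · have hpt : ∀ y, (g y).fst = u y ∧ (g y).snd = u y := by
      intro y
      have h1 : (g y).fst ∈ (NonemptyInterval.pure (u y) : Set ℝ) :=
        hg y ⟨le_rfl, (g y).fst_le_snd⟩
      have h2 : (g y).snd ∈ (NonemptyInterval.pure (u y) : Set ℝ) :=
        hg y ⟨(g y).fst_le_snd, le_rfl⟩
      simpa using And.intro h1 h2
    intro x
    change lowerBaire g x = (u x : EReal) ∧ upperBaire g x = (u x : EReal)
    simp only [lowerBaire, upperBaire, hpt]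
    constructor
    · apply le_antisymm
      · exact iSup₂_le fun δ hδ => iInf₂_le x (Metric.mem_ball_self hδ)
      · refine EReal.ge_of_forall_gt_iff_ge.1 fun z hz => ?_
        obtain ⟨δ, hδ, h⟩ := key x (u x - z) (sub_pos.2 (EReal.coe_lt_coe_iff.1 hz))
        refine le_iSup₂_of_le δ hδ (le_iInf₂ fun y hy => ?_)
        have := (abs_lt.1 (h y hy)).1
        exact EReal.coe_le_coe_iff.2 (by linarith)
    · apply le_antisymm
      · refine EReal.le_of_forall_lt_iff_le.1 fun z hz => ?_
        obtain ⟨δ, hδ, h⟩ := key x (z - u x) (sub_pos.2 (EReal.coe_lt_coe_iff.1 hz))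
        refine iInf₂_le_of_le δ hδ (iSup₂_le fun y hy => ?_)
        have := (abs_lt.1 (h y hy)).2
        exact EReal.coe_le_coe_iff.2 (by linarith)
      · exact le_iInf₂ fun δ hδ => le_iSup₂_of_le x (Metric.mem_ball_self hδ) le_rfl

/-- The embedding of `C(X)` into `ℍ(X)`, `u ↦ [u, u]`. -/
def ofContinuous {X : Type*} [PseudoMetricSpace X] (u : C(X, ℝ)) : HFun X :=
  ⟨fun x => NonemptyInterval.pure (u x), isHContinuous_pure u⟩

/-- Order convergence of a sequence in a partially ordered set. -/
def OrderConverges {P : Type*} [PartialOrder P] (ξ : ℕ → P) (p : P) : Prop :=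
  ∃ α β : ℕ → P, Monotone α ∧ Antitone β ∧ (∀ n, α n ≤ ξ n ∧ ξ n ≤ β n) ∧
    IsLUB (Set.range α) p ∧ IsGLB (Set.range β) p

/-- Cauchy sequences in `C(X)`: there is a decreasing sequence `β` in `C(X)` with infimum `0` in
the ordered set `C(X)` and `u m - u k ≤ β n` for all `m, k ≥ n`. -/
def IsCauchySequence {X : Type*} [PseudoMetricSpace X] (u : ℕ → C(X, ℝ)) : Prop :=
  ∃ β : ℕ → C(X, ℝ), Antitone β ∧ IsGLB (Set.range β) 0 ∧
    ∀ n m k, n ≤ m → n ≤ k → u m - u k ≤ β n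

/-- `u` is a Cauchy sequence in `C(X)` that order converges to `f` in `ℍ(X)`. -/
def CauchyConverges {X : Type*} [PseudoMetricSpace X] (u : ℕ → C(X, ℝ)) (f : HFun X) : Prop :=
  IsCauchySequence u ∧ OrderConverges (fun n => ofContinuous (u n)) f

end HausdorffContinuous

open HausdorffContinuous

/-!
Call two sequences `u`, `v` in `C(X)` jointly Cauchy if `|u m - v k| ≤ γ n` for all `m, k ≥ n`, with
`γ` decreasing to `0` in `C(X)`. Cauchy sequences with a common order limit are jointly Cauchy, and
sums and products of jointly Cauchy pairs are again jointly Cauchy. Conversely, a jointly Cauchy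
pair is squeezed between an increasing sequence `α` and a decreasing sequence `β` in `C(X)` whose
difference decreases to `0`. The supremum of `α` exists in `ℍ(X)`, and it is also the infimum of
`β`: a sequence decreasing to `0` in `C(X)` comes arbitrarily close to `0` on every neighbourhood,
so that an inequality between Hausdorff continuous functions which holds up to such a sequence holds
exactly. Hence both sequences of the pair have the same order limit.
-/

open Filter Topology

namespace HausdorffContinuous

section OrderConvergence

variable {P : Type*} [PartialOrder P] {ξ η : ℕ → P} {c p q : P}

theorem OrderConverges.ge_of_eventually (hξ : OrderConverges ξ p) (hc : ∀ᶠ n in atTop, c ≤ ξ n) :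
    c ≤ p := by
  obtain ⟨_, β, _, hβ, hbounds, _, hinf⟩ := hξ
  refine hinf.2 (Set.forall_mem_range.2 fun m => ?_)
  obtain ⟨n, hcn, hmn⟩ := (hc.and (eventually_ge_atTop m)).exists
  exact hcn.trans ((hbounds n).2.trans (hβ hmn))

theorem OrderConverges.le_of_eventually (hξ : OrderConverges ξ p) (hc : ∀ᶠ n in atTop, ξ n ≤ c) :
    p ≤ c := by
  obtain ⟨α, _, hα, _, hbounds, hsup, _⟩ := hξ
  refine hsup.2 (Set.forall_mem_range.2 fun m => ?_)
  obtain ⟨n, hcn, hmn⟩ := (hc.and (eventually_ge_atTop m)).exists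
  exact (hα hmn).trans ((hbounds n).1.trans hcn)

theorem OrderConverges.le_of_le (hξ : OrderConverges ξ p) (hη : OrderConverges η q)
    (h : ∀ n, ξ n ≤ η n) : p ≤ q := by
  obtain ⟨α, _, hα, _, hbounds, hsup, _⟩ := hξ
  refine hsup.2 (Set.forall_mem_range.2 fun m => hη.ge_of_eventually ?_)
  filter_upwards [eventually_ge_atTop m] with n hmn
  exact (hα hmn).trans ((hbounds n).1.trans (h n))

theorem OrderConverges.unique (hp : OrderConverges ξ p) (hq : OrderConverges ξ q) : p = q :=
  (hp.le_of_le hq fun _ => le_rfl).antisymm (hq.le_of_le hp fun _ => le_rfl)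

end OrderConvergence

section DecreasesToZero

/-- The sequence `γ` is decreasing with infimum `0`. In `C(X)` this is weaker than decreasing
pointwise to `0`, since the infimum is taken in `C(X)`. -/
structure DecreasesToZero {P : Type*} [Preorder P] [Zero P] (γ : ℕ → P) : Prop where
  antitone : Antitone γ
  isGLB : IsGLB (Set.range γ) 0

section Preorder

variable {P : Type*} [Preorder P] [Zero P] {γ δ : ℕ → P}

theorem DecreasesToZero.nonneg (hγ : DecreasesToZero γ) (n : ℕ) : 0 ≤ γ n :=
  hγ.isGLB.1 ⟨n, rfl⟩

theorem DecreasesToZero.le_zero (hγ : DecreasesToZero γ) {w : P} (hw : ∀ n, w ≤ γ n) : w ≤ 0 :=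
  hγ.isGLB.2 (Set.forall_mem_range.2 hw)

theorem decreasesToZero_of_forall_le_zero (hγ : Antitone γ) (hγ₀ : ∀ n, 0 ≤ γ n)
    (h : ∀ w, (∀ n, w ≤ γ n) → w ≤ 0) : DecreasesToZero γ :=
  ⟨hγ, Set.forall_mem_range.2 hγ₀, fun w hw => h w fun n => hw ⟨n, rfl⟩⟩

theorem DecreasesToZero.of_le (hδ : DecreasesToZero δ) (hγ : Antitone γ) (hγ₀ : ∀ n, 0 ≤ γ n)
    (hle : ∀ n, γ n ≤ δ n) : DecreasesToZero γ :=
  decreasesToZero_of_forall_le_zero hγ hγ₀ fun _ hw => hδ.le_zero fun n => (hw n).trans (hle n)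

end Preorder

theorem DecreasesToZero.add {G : Type*} [AddCommGroup G] [PartialOrder G] [IsOrderedAddMonoid G]
    {γ δ : ℕ → G} (hγ : DecreasesToZero γ) (hδ : DecreasesToZero δ) :
    DecreasesToZero fun n => γ n + δ n := by
  refine decreasesToZero_of_forall_le_zero (hγ.antitone.add hδ.antitone)
    (fun n => add_nonneg (hγ.nonneg n) (hδ.nonneg n)) fun w hw => ?_
  have hw' (n m : ℕ) : w ≤ γ n + δ m := (hw (max n m)).trans
    (add_le_add (hγ.antitone (le_max_left n m)) (hδ.antitone (le_max_right n m)))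
  exact hδ.le_zero fun m => sub_nonpos.1 (hγ.le_zero fun n => sub_le_iff_le_add.2 (hw' n m))

variable {X : Type*} [TopologicalSpace X] {γ : ℕ → C(X, ℝ)}

theorem DecreasesToZero.mul_left (hγ : DecreasesToZero γ) {a : C(X, ℝ)} (ha : 0 ≤ a) :
    DecreasesToZero fun n => a * γ n := by
  refine decreasesToZero_of_forall_le_zero
    (fun m n hmn => mul_le_mul_of_nonneg_left (hγ.antitone hmn) ha)
    (fun n => mul_nonneg ha (hγ.nonneg n)) fun w hw => ?_
  have hpos (x : X) : 0 < 1 + a x := add_pos_of_pos_of_nonneg one_pos (ha x)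
  -- `a` may vanish, so a lower bound of `a * γ n` is divided by `1 + a` instead.
  let w' : C(X, ℝ) := ⟨fun x => w x / (1 + a x),
    w.continuous.div (continuous_const.add a.continuous) fun x => (hpos x).ne'⟩
  have hw' : w' ≤ 0 := hγ.le_zero fun n x => (div_le_iff₀' (hpos x)).2 <|
    calc w x ≤ a x * γ n x := hw n x
      _ ≤ (1 + a x) * γ n x :=
        mul_le_mul_of_nonneg_right (le_add_of_nonneg_left zero_le_one) (hγ.nonneg n x)
  exact fun x => by simpa using (div_le_iff₀ (hpos x)).1 (hw' x)

theorem DecreasesToZero.exists_lt [CompletelyRegularSpace X] (hγ : DecreasesToZero γ) {x : X}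
    {s : Set X} (hs : s ∈ 𝓝 x) {ε : ℝ} (hε : 0 < ε) : ∃ n, ∃ y ∈ s, γ n y < ε := by
  by_contra! hge
  obtain ⟨f, hf, hfx, hfs⟩ := CompletelyRegularSpace.completely_regular x (interior s)ᶜ
    isOpen_interior.isClosed_compl (Set.notMem_compl_iff.2 (mem_interior_iff_mem_nhds.2 hs))
  let bump : C(X, ℝ) := ⟨fun y => ε * (1 - f y), by fun_prop⟩
  have hbump : bump ≤ 0 := hγ.le_zero fun n y => by
    by_cases hy : y ∈ interior s
    · calc ε * (1 - f y) ≤ ε := mul_le_of_le_one_right hε.le (sub_le_self 1 (f y).2.1)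
        _ ≤ γ n y := hge n y (interior_subset hy)
    · calc ε * (1 - f y) = 0 := by simp [hfs hy]
        _ ≤ γ n y := hγ.nonneg n y
  have hx : ε * (1 - f x) ≤ 0 := hbump x
  rw [hfx, Set.Icc.coe_zero, sub_zero, mul_one] at hx
  exact hx.not_gt hε

end DecreasesToZero

section JointlyCauchy

section LatticeOrderedGroup

variable {G : Type*} [AddCommGroup G] [Lattice G] {u v u' v' : ℕ → G}

/-- The joint Cauchy condition on two sequences, equivalent to `u 0, v 0, u 1, v 1, …` being a
Cauchy sequence. A sequence `u` in `C(X)` is Cauchy exactly if `JointlyCauchy u u`. -/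
def JointlyCauchy (u v : ℕ → G) : Prop :=
  ∃ γ : ℕ → G, DecreasesToZero γ ∧ ∀ n m k, n ≤ m → n ≤ k → |u m - v k| ≤ γ n

theorem JointlyCauchy.symm (h : JointlyCauchy u v) : JointlyCauchy v u := by
  obtain ⟨γ, hγ, huv⟩ := h
  exact ⟨γ, hγ, fun n m k hm hk => abs_sub_comm (v m) (u k) ▸ huv n k m hk hm⟩

variable [IsOrderedAddMonoid G]

theorem JointlyCauchy.add (hu : JointlyCauchy u u') (hv : JointlyCauchy v v') :
    JointlyCauchy (fun n => u n + v n) fun n => u' n + v' n := by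
  obtain ⟨γ, hγ, hu⟩ := hu
  obtain ⟨δ, hδ, hv⟩ := hv
  refine ⟨_, hγ.add hδ, fun n m k hm hk => ?_⟩
  calc |u m + v m - (u' k + v' k)| = |(u m - u' k) + (v m - v' k)| := by rw [add_sub_add_comm]
    _ ≤ |u m - u' k| + |v m - v' k| := abs_add_le _ _
    _ ≤ γ n + δ n := add_le_add (hu n m k hm hk) (hv n m k hm hk)

theorem JointlyCauchy.exists_abs_le (h : JointlyCauchy u v) : ∃ a, ∀ n, |u n| ≤ a := by
  obtain ⟨γ, -, huv⟩ := h
  refine ⟨γ 0 + |v 0|, fun n => ?_⟩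
  calc |u n| = |(u n - v 0) + v 0| := by rw [sub_add_cancel]
    _ ≤ |u n - v 0| + |v 0| := abs_add_le _ _
    _ ≤ γ 0 + |v 0| := by gcongr; exact huv 0 n 0 n.zero_le le_rfl

theorem JointlyCauchy.exists_common_bound (h : JointlyCauchy u v) :
    ∃ δ : ℕ → G, DecreasesToZero δ ∧
      ∀ k n, k ≤ n → |u k - u n| ≤ δ k ∧ |u k - v n| ≤ δ k := by
  obtain ⟨γ, hγ, huv⟩ := h
  refine ⟨_, hγ.add hγ, fun k n hkn => ⟨?_, ?_⟩⟩
  · calc |u k - u n| = |(u k - v k) + (v k - u n)| := by rw [sub_add_sub_cancel]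
      _ ≤ |u k - v k| + |v k - u n| := abs_add_le _ _
      _ ≤ γ k + γ k := add_le_add (huv k k k le_rfl le_rfl)
        (abs_sub_comm (v k) (u n) ▸ huv k n k hkn le_rfl)
  · exact (huv k k n le_rfl hkn).trans (le_add_of_nonneg_left (hγ.nonneg k))

theorem JointlyCauchy.exists_squeeze (h : JointlyCauchy u v) :
    ∃ α β : ℕ → G, Monotone α ∧ Antitone β ∧ DecreasesToZero (β - α) ∧
      ∀ n, (α n ≤ u n ∧ u n ≤ β n) ∧ α n ≤ v n ∧ v n ≤ β n := by
  obtain ⟨δ, hδ, huv⟩ := h.exists_common_bound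
  let α : ℕ → G := fun n => partialSups (fun k => u k - δ k) n
  let β : ℕ → G := fun n => -partialSups (fun k => -(u k + δ k)) n
  have α_le {w : ℕ → G} (hw : ∀ k n, k ≤ n → |u k - w n| ≤ δ k) (n : ℕ) : α n ≤ w n :=
    partialSups_le _ _ _ fun k hk => sub_le_comm.1 ((le_abs_self _).trans (hw k n hk))
  have le_β {w : ℕ → G} (hw : ∀ k n, k ≤ n → |u k - w n| ≤ δ k) (n : ℕ) : w n ≤ β n :=
    le_neg_of_le_neg <| partialSups_le _ _ _ fun k hk => neg_le_neg <|
      sub_le_iff_le_add'.1 (((le_abs_self _).trans (abs_sub_comm _ _).le).trans (hw k n hk))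
  have hu (k n : ℕ) (hkn : k ≤ n) := (huv k n hkn).1
  have hv (k n : ℕ) (hkn : k ≤ n) := (huv k n hkn).2
  have hα : Monotone α := (partialSups _).monotone
  have hβ : Antitone β := fun m n hmn => neg_le_neg ((partialSups _).monotone hmn)
  have hβα (n : ℕ) : (β - α) n ≤ δ n + δ n := by
    have hαn : u n - δ n ≤ α n := le_partialSups (fun k => u k - δ k) n
    have hβn : β n ≤ u n + δ n := neg_le.1 (le_partialSups (fun k => -(u k + δ k)) n)
    calc β n - α n ≤ (u n + δ n) - (u n - δ n) := sub_le_sub hβn hαn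
      _ = δ n + δ n := by abel
  exact ⟨α, β, hα, hβ,
    (hδ.add hδ).of_le (fun m n hmn => sub_le_sub (hβ hmn) (hα hmn))
      (fun n => sub_nonneg.2 ((α_le hu n).trans (le_β hu n))) hβα,
    fun n => ⟨⟨α_le hu n, le_β hu n⟩, α_le hv n, le_β hv n⟩⟩

end LatticeOrderedGroup

theorem JointlyCauchy.mul {X : Type*} [TopologicalSpace X] {u v u' v' : ℕ → C(X, ℝ)}
    (hu : JointlyCauchy u u') (hv : JointlyCauchy v v') :
    JointlyCauchy (fun n => u n * v n) fun n => u' n * v' n := by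
  obtain ⟨a, ha⟩ := hu.exists_abs_le
  obtain ⟨b, hb⟩ := hv.symm.exists_abs_le
  have ha₀ : 0 ≤ a := (abs_nonneg _).trans (ha 0)
  have hb₀ : 0 ≤ b := (abs_nonneg _).trans (hb 0)
  obtain ⟨γ, hγ, hu⟩ := hu
  obtain ⟨δ, hδ, hv⟩ := hv
  refine ⟨_, (hδ.mul_left ha₀).add (hγ.mul_left hb₀), fun n m k hm hk x => ?_⟩
  calc |u m x * v m x - u' k x * v' k x|
      = |u m x * (v m x - v' k x) + v' k x * (u m x - u' k x)| := by ring_nf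
    _ ≤ |u m x| * |v m x - v' k x| + |v' k x| * |u m x - u' k x| := by
      rw [← abs_mul, ← abs_mul]
      exact abs_add_le _ _
    _ ≤ a x * δ n x + b x * γ n x :=
      add_le_add (mul_le_mul (ha m x) (hv n m k hm hk x) (abs_nonneg _) (ha₀ x))
        (mul_le_mul (hb k x) (hu n m k hm hk x) (abs_nonneg _) (hb₀ x))

end JointlyCauchy

section SemicontinuousEnvelopes

variable {X Y : Type*} [TopologicalSpace X] [CompleteLinearOrder Y]

theorem liminf_nhds_le (h : X → Y) (x : X) : liminf h (𝓝 x) ≤ h x :=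
  le_of_forall_lt fun _ hc => (eventually_lt_of_lt_liminf hc).self_of_nhds

theorem le_limsup_nhds (h : X → Y) (x : X) : h x ≤ limsup h (𝓝 x) :=
  liminf_nhds_le (Y := Yᵒᵈ) h x

theorem lowerSemicontinuous_liminf_nhds (h : X → Y) :
    LowerSemicontinuous fun x => liminf h (𝓝 x) := fun x c hc => by
  obtain ⟨a, ha, hca⟩ := lt_sSup_iff.1 (hc.trans_eq liminf_eq)
  filter_upwards [eventually_eventually_nhds.2 ha] with y hy
  exact hca.trans_le (le_liminf_of_le (h := hy))

theorem upperSemicontinuous_limsup_nhds (h : X → Y) :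
    UpperSemicontinuous fun x => limsup h (𝓝 x) :=
  lowerSemicontinuous_liminf_nhds (Y := Yᵒᵈ) h

theorem le_liminf_limsup_nhds {h : X → Y} (hh : LowerSemicontinuous h) (x : X) :
    h x ≤ liminf (fun y => limsup h (𝓝 y)) (𝓝 x) :=
  (hh.le_liminf x).trans (liminf_le_liminf (.of_forall (le_limsup_nhds h)))

theorem limsup_liminf_limsup_nhds {h : X → Y} (hh : LowerSemicontinuous h) (x : X) :
    limsup (fun y => liminf (fun z => limsup h (𝓝 z)) (𝓝 y)) (𝓝 x) = limsup h (𝓝 x) := by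
  apply le_antisymm
  · calc limsup (fun y => liminf (fun z => limsup h (𝓝 z)) (𝓝 y)) (𝓝 x)
        ≤ limsup (fun y => limsup h (𝓝 y)) (𝓝 x) :=
          limsup_le_limsup (.of_forall (liminf_nhds_le _))
      _ ≤ limsup h (𝓝 x) := (upperSemicontinuous_limsup_nhds h).limsup_le x
  · exact limsup_le_limsup (.of_forall (le_liminf_limsup_nhds hh))

end SemicontinuousEnvelopes

section HausdorffContinuity

variable {X : Type*} [PseudoMetricSpace X]

theorem lowerBaire_eq_liminf (f : X → NonemptyInterval ℝ) (x : X) :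
    lowerBaire f x = liminf (fun y => ((f y).fst : EReal)) (𝓝 x) :=
  Metric.nhds_basis_ball.liminf_eq_iSup_iInf.symm

theorem upperBaire_eq_limsup (f : X → NonemptyInterval ℝ) (x : X) :
    upperBaire f x = limsup (fun y => ((f y).snd : EReal)) (𝓝 x) :=
  Metric.nhds_basis_ball.limsup_eq_iInf_iSup.symm

theorem LocallyBounded.of_modulus_le {f g : X → NonemptyInterval ℝ} (hf : LocallyBounded f)
    (hgf : ∀ x, modulus (g x) ≤ modulus (f x)) : LocallyBounded g := fun x => by
  obtain ⟨δ, hδ, M, hM⟩ := hf x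
  exact ⟨δ, hδ, M, fun y hy => (hgf y).trans_lt (hM y hy)⟩

theorem locallyBounded_of_continuous_le {f : X → NonemptyInterval ℝ} {a b : C(X, ℝ)}
    (ha : ∀ x, a x ≤ (f x).fst) (hb : ∀ x, (f x).snd ≤ b x) : LocallyBounded f := fun x => by
  have hmodulus (y : X) : modulus (f y) ≤ max |a y| |b y| := max_le
    (abs_le_max_abs_abs (ha y) ((f y).fst_le_snd.trans (hb y)))
    (abs_le_max_abs_abs ((ha y).trans (f y).fst_le_snd) (hb y))
  have hcont : ContinuousAt (fun y => max |a y| |b y|) x := by fun_prop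
  obtain ⟨δ, hδ, hlt⟩ :=
    Metric.eventually_nhds_iff_ball.1 (hcont.eventually_lt_const (lt_add_one _))
  exact ⟨δ, hδ, _, fun y hy => (hmodulus y).trans_lt (hlt y hy)⟩

theorem IsHContinuous.liminf_snd {f : X → NonemptyInterval ℝ} (hf : IsHContinuous f) (x : X) :
    liminf (fun y => ((f y).snd : EReal)) (𝓝 x) = (f x).fst := by
  have hcompletion : GraphCompletionEq (fun y => NonemptyInterval.pure (f y).snd) f :=
    hf.2 _ (hf.1.of_modulus_le fun y => max_le (le_max_right _ _) (le_max_right _ _))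
      fun y => NonemptyInterval.coe_subset_coe.2 ⟨(f y).fst_le_snd, le_rfl⟩
  exact (lowerBaire_eq_liminf _ x).symm.trans (hcompletion x).1

theorem IsHContinuous.limsup_fst {f : X → NonemptyInterval ℝ} (hf : IsHContinuous f) (x : X) :
    limsup (fun y => ((f y).fst : EReal)) (𝓝 x) = (f x).snd := by
  have hcompletion : GraphCompletionEq (fun y => NonemptyInterval.pure (f y).fst) f :=
    hf.2 _ (hf.1.of_modulus_le fun y => max_le (le_max_left _ _) (le_max_left _ _))
      fun y => NonemptyInterval.coe_subset_coe.2 ⟨le_rfl, (f y).fst_le_snd⟩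
  exact (upperBaire_eq_limsup _ x).symm.trans (hcompletion x).2

theorem isHContinuous_of_liminf_limsup {f : X → NonemptyInterval ℝ} (hf : LocallyBounded f)
    (hfst : ∀ x, liminf (fun y => ((f y).snd : EReal)) (𝓝 x) = (f x).fst)
    (hsnd : ∀ x, limsup (fun y => ((f y).fst : EReal)) (𝓝 x) = (f x).snd) : IsHContinuous f := by
  refine ⟨hf, fun g _ hgf x => ?_⟩
  have hlsc : LowerSemicontinuous fun y => ((f y).fst : EReal) := by
    simpa only [hfst] using lowerSemicontinuous_liminf_nhds fun y => ((f y).snd : EReal)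
  have husc : UpperSemicontinuous fun y => ((f y).snd : EReal) := by
    simpa only [hsnd] using upperSemicontinuous_limsup_nhds fun y => ((f y).fst : EReal)
  have hgf' (y : X) := NonemptyInterval.le_def.1 (NonemptyInterval.coe_subset_coe.1 (hgf y))
  rw [lowerBaire_eq_liminf, upperBaire_eq_limsup]
  refine ⟨le_antisymm ?_ ?_, le_antisymm ?_ ?_⟩
  · rw [← hfst x]
    exact liminf_le_liminf (.of_forall fun y =>
      EReal.coe_le_coe_iff.2 ((g y).fst_le_snd.trans (hgf' y).2))
  · exact (hlsc.le_liminf x).trans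
      (liminf_le_liminf (.of_forall fun y => EReal.coe_le_coe_iff.2 (hgf' y).1))
  · exact (limsup_le_limsup (.of_forall fun y => EReal.coe_le_coe_iff.2 (hgf' y).2)).trans
      (husc.limsup_le x)
  · rw [← hsnd x]
    exact limsup_le_limsup (.of_forall fun y =>
      EReal.coe_le_coe_iff.2 ((hgf' y).1.trans (g y).fst_le_snd))

end HausdorffContinuity

section HFun

variable {X : Type*} [PseudoMetricSpace X]

theorem HFun.lowerSemicontinuous_fst (f : HFun X) :
    LowerSemicontinuous fun x => (f.toFun x).fst := fun x c hc => by
  have hlsc := lowerSemicontinuous_liminf_nhds fun y => ((f.toFun y).snd : EReal)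
  simp only [f.isHContinuous.liminf_snd] at hlsc
  exact (hlsc x c (EReal.coe_lt_coe_iff.2 hc)).mono fun _ => EReal.coe_lt_coe_iff.1

theorem HFun.upperSemicontinuous_snd (f : HFun X) :
    UpperSemicontinuous fun x => (f.toFun x).snd := fun x c hc => by
  have husc := upperSemicontinuous_limsup_nhds fun y => ((f.toFun y).fst : EReal)
  simp only [f.isHContinuous.limsup_fst] at husc
  exact (husc x c (EReal.coe_lt_coe_iff.2 hc)).mono fun _ => EReal.coe_lt_coe_iff.1

theorem HFun.frequently_lt_fst (f : HFun X) {x : X} {c : ℝ} (hc : c < (f.toFun x).snd) :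
    ∃ᶠ y in 𝓝 x, c < (f.toFun y).fst := by
  have hlimsup : (c : EReal) < limsup (fun y => ((f.toFun y).fst : EReal)) (𝓝 x) := by
    rw [f.isHContinuous.limsup_fst]
    exact EReal.coe_lt_coe_iff.2 hc
  exact (frequently_lt_of_lt_limsup (h := hlimsup)).mono fun _ => EReal.coe_lt_coe_iff.1

theorem HFun.le_of_snd_le {f g : HFun X} (h : ∀ x, (f.toFun x).snd ≤ (g.toFun x).snd) :
    f ≤ g := fun x => by
  refine ⟨EReal.coe_le_coe_iff.1 ?_, h x⟩
  rw [← f.isHContinuous.liminf_snd, ← g.isHContinuous.liminf_snd]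
  exact liminf_le_liminf (.of_forall fun y => EReal.coe_le_coe_iff.2 (h y))

theorem HFun.le_of_forall_fst_le_snd_add {f g : HFun X} {γ : ℕ → C(X, ℝ)}
    (hγ : DecreasesToZero γ) (h : ∀ n x, (f.toFun x).fst ≤ (g.toFun x).snd + γ n x) :
    f ≤ g := by
  refine HFun.le_of_snd_le fun x => ?_
  by_contra! hlt
  obtain ⟨c, hgc, hcf⟩ := exists_between hlt
  obtain ⟨e, hce, hef⟩ := exists_between hcf
  have hg : ∀ᶠ y in 𝓝 x, ∀ᶠ z in 𝓝 y, (g.toFun z).snd < c :=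
    eventually_eventually_nhds.2 (g.upperSemicontinuous_snd x c hgc)
  obtain ⟨y, hefy, hgy⟩ := ((f.frequently_lt_fst hef).and_eventually hg).exists
  obtain ⟨n, z, ⟨hefz, hgz⟩, hγz⟩ :=
    hγ.exists_lt ((f.lowerSemicontinuous_fst y e hefy).and hgy) (sub_pos.2 hce)
  linarith [h n z]

theorem exists_hFun_of_liminf_limsup {L T : X → EReal} {a b : C(X, ℝ)}
    (ha : ∀ x, (a x : EReal) ≤ L x) (hb : ∀ x, T x ≤ b x)
    (hL : ∀ x, liminf T (𝓝 x) = L x) (hT : ∀ x, limsup L (𝓝 x) = T x) :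
    ∃ p : HFun X, ∀ x, ((p.toFun x).fst : EReal) = L x ∧ ((p.toFun x).snd : EReal) = T x := by
  have hLT (x : X) : L x ≤ T x := (hL x).symm.trans_le (liminf_nhds_le T x)
  lift L to X → ℝ using fun x =>
    ⟨(((hLT x).trans (hb x)).trans_lt (EReal.coe_lt_top _)).ne,
      ((EReal.bot_lt_coe _).trans_le (ha x)).ne'⟩
  lift T to X → ℝ using fun x =>
    ⟨((hb x).trans_lt (EReal.coe_lt_top _)).ne,
      ((EReal.bot_lt_coe _).trans_le (hLT x)).ne'⟩
  let f : X → NonemptyInterval ℝ := fun x => ⟨(L x, T x), EReal.coe_le_coe_iff.1 (hLT x)⟩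
  have hf : LocallyBounded f := locallyBounded_of_continuous_le
    (fun x => EReal.coe_le_coe_iff.1 (ha x)) fun x => EReal.coe_le_coe_iff.1 (hb x)
  exact ⟨⟨f, isHContinuous_of_liminf_limsup hf hL hT⟩, fun _ => ⟨rfl, rfl⟩⟩

theorem exists_isLUB_range_ofContinuous {ι : Type*} [Nonempty ι] {α : ι → C(X, ℝ)}
    (hα : BddAbove (Set.range α)) :
    ∃ p : HFun X, IsLUB (Set.range fun i => ofContinuous (α i)) p := by
  obtain ⟨b, hb⟩ := hα
  let A : X → EReal := fun x => ⨆ i, (α i x : EReal)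
  have hαA (i : ι) (x : X) : (α i x : EReal) ≤ A x := le_iSup (fun i => (α i x : EReal)) i
  have hA : LowerSemicontinuous A := lowerSemicontinuous_iSup fun i =>
    (continuous_coe_real_ereal.comp (α i).continuous).lowerSemicontinuous
  have hlimsup (x : X) : limsup A (𝓝 x) ≤ b x := by
    have hb_usc : UpperSemicontinuous fun y => (b y : EReal) :=
      (continuous_coe_real_ereal.comp b.continuous).upperSemicontinuous
    exact (limsup_le_limsup (.of_forall fun y => iSup_le fun i =>
      EReal.coe_le_coe_iff.2 (hb ⟨i, rfl⟩ y))).trans (hb_usc.limsup_le x)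
  obtain ⟨p, hp⟩ := exists_hFun_of_liminf_limsup
    (fun x => (hαA (Classical.arbitrary ι) x).trans (le_liminf_limsup_nhds hA x)) hlimsup
    (fun _ => rfl) (limsup_liminf_limsup_nhds hA)
  have hαp (i : ι) (x : X) : α i x ≤ (p.toFun x).fst := EReal.coe_le_coe_iff.1 <|
    (hαA i x).trans ((le_liminf_limsup_nhds hA x).trans_eq (hp x).1.symm)
  refine ⟨p, Set.forall_mem_range.2 fun i x =>
    ⟨hαp i x, (hαp i x).trans (p.toFun x).fst_le_snd⟩, fun q hq => HFun.le_of_snd_le fun x => ?_⟩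
  rw [← EReal.coe_le_coe_iff, (hp x).2, ← q.isHContinuous.limsup_fst]
  exact limsup_le_limsup (.of_forall fun y => iSup_le fun i =>
    EReal.coe_le_coe_iff.2 (hq ⟨i, rfl⟩ y).1)

theorem ofContinuous_le_ofContinuous {u v : C(X, ℝ)} :
    ofContinuous u ≤ ofContinuous v ↔ u ≤ v :=
  ⟨fun h x => (h x).1, fun h x => ⟨h x, h x⟩⟩

theorem exists_isLUB_isGLB_ofContinuous {α β : ℕ → C(X, ℝ)} (hα : Monotone α) (hβ : Antitone β)
    (hβα : DecreasesToZero (β - α)) :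
    ∃ p : HFun X, IsLUB (Set.range fun n => ofContinuous (α n)) p ∧
      IsGLB (Set.range fun n => ofContinuous (β n)) p := by
  have hle : ∀ m n, α m ≤ β n :=
    hα.forall_le_of_antitone hβ fun n => sub_nonneg.1 (hβα.nonneg n)
  obtain ⟨p, hp⟩ :=
    exists_isLUB_range_ofContinuous ⟨β 0, Set.forall_mem_range.2 fun m => hle m 0⟩
  refine ⟨p, hp, Set.forall_mem_range.2 fun n => hp.2 <| Set.forall_mem_range.2 fun m =>
    ofContinuous_le_ofContinuous.2 (hle m n), fun q hq => ?_⟩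
  refine HFun.le_of_forall_fst_le_snd_add hβα fun n x => ?_
  calc (q.toFun x).fst ≤ β n x := (hq ⟨n, rfl⟩ x).1
    _ = α n x + (β - α) n x := (add_sub_cancel (α n x) (β n x)).symm
    _ ≤ (p.toFun x).snd + (β - α) n x := by gcongr; exact (hp.1 ⟨n, rfl⟩ x).2

end HFun

section CauchySequences

variable {X : Type*} [PseudoMetricSpace X] {u v : ℕ → C(X, ℝ)} {f : HFun X}

theorem JointlyCauchy.exists_orderConverges (h : JointlyCauchy u v) :
    ∃ p : HFun X, OrderConverges (fun n => ofContinuous (u n)) p ∧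
      OrderConverges (fun n => ofContinuous (v n)) p := by
  obtain ⟨α, β, hα, hβ, hβα, hbounds⟩ := h.exists_squeeze
  obtain ⟨p, hsup, hinf⟩ := exists_isLUB_isGLB_ofContinuous hα hβ hβα
  have orderConverges {w : ℕ → C(X, ℝ)} (hw : ∀ n, α n ≤ w n ∧ w n ≤ β n) :
      OrderConverges (fun n => ofContinuous (w n)) p :=
    ⟨_, _, fun _ _ hmn => ofContinuous_le_ofContinuous.2 (hα hmn),
      fun _ _ hmn => ofContinuous_le_ofContinuous.2 (hβ hmn),
      fun n => (hw n).imp ofContinuous_le_ofContinuous.2 ofContinuous_le_ofContinuous.2,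
      hsup, hinf⟩
  exact ⟨p, orderConverges fun n => (hbounds n).1, orderConverges fun n => (hbounds n).2⟩

theorem CauchyConverges.exists_error_bound (hu : CauchyConverges u f) :
    ∃ γ : ℕ → C(X, ℝ), DecreasesToZero γ ∧ ∀ n m, n ≤ m →
      ofContinuous (u m - γ n) ≤ f ∧ f ≤ ofContinuous (u m + γ n) := by
  obtain ⟨⟨γ, hγ, hγ₀, hcauchy⟩, hlim⟩ := hu
  refine ⟨γ, ⟨hγ, hγ₀⟩, fun n m hm => ⟨hlim.ge_of_eventually ?_, hlim.le_of_eventually ?_⟩⟩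
  all_goals
    filter_upwards [eventually_ge_atTop n] with k hk
    apply ofContinuous_le_ofContinuous.2
  · exact sub_le_comm.1 (hcauchy n m k hm hk)
  · exact sub_le_iff_le_add'.1 (hcauchy n k m hk hm)

theorem CauchyConverges.jointlyCauchy (hu : CauchyConverges u f) (hv : CauchyConverges v f) :
    JointlyCauchy u v := by
  obtain ⟨γ, hγ, hu⟩ := hu.exists_error_bound
  obtain ⟨δ, hδ, hv⟩ := hv.exists_error_bound
  refine ⟨_, hγ.add hδ, fun n m k hm hk => abs_le'.2 ⟨?_, ?_⟩⟩
  · have hle : u m - γ n ≤ v k + δ n :=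
      ofContinuous_le_ofContinuous.1 ((hu n m hm).1.trans (hv n k hk).2)
    rw [sub_le_iff_le_add] at hle ⊢
    exact hle.trans_eq (by abel)
  · have hle : v k - δ n ≤ u m + γ n :=
      ofContinuous_le_ofContinuous.1 ((hv n k hk).1.trans (hu n m hm).2)
    rw [neg_sub, sub_le_iff_le_add]
    exact (sub_le_iff_le_add.1 hle).trans_eq (by abel)

theorem JointlyCauchy.existsUnique_orderConverges (h : JointlyCauchy u u) :
    ∃! p : HFun X, OrderConverges (fun n => ofContinuous (u n)) p := by
  obtain ⟨p, hp, -⟩ := h.exists_orderConverges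
  exact ⟨p, hp, fun _ hq => hq.unique hp⟩

theorem JointlyCauchy.orderLimit_eq (h : JointlyCauchy u v) {p q : HFun X}
    (hp : OrderConverges (fun n => ofContinuous (u n)) p)
    (hq : OrderConverges (fun n => ofContinuous (v n)) q) : p = q := by
  obtain ⟨r, hur, hvr⟩ := h.exists_orderConverges
  exact (hp.unique hur).trans (hvr.unique hq)

end CauchySequences

end HausdorffContinuous

theorem mainTheorem6_general {X : Type*} [PseudoMetricSpace X] (f g : HFun X) :
    (∀ u v : ℕ → C(X, ℝ), CauchyConverges u f → CauchyConverges v g →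
      (∃! p : HFun X, OrderConverges (fun n => ofContinuous (u n + v n)) p) ∧
      (∃! q : HFun X, OrderConverges (fun n => ofContinuous (u n * v n)) q)) ∧
    (∀ u₁ u₂ v₁ v₂ : ℕ → C(X, ℝ),
      CauchyConverges u₁ f → CauchyConverges u₂ f →
      CauchyConverges v₁ g → CauchyConverges v₂ g →
      (∀ p₁ p₂ : HFun X,
        OrderConverges (fun n => ofContinuous (u₁ n + v₁ n)) p₁ →
        OrderConverges (fun n => ofContinuous (u₂ n + v₂ n)) p₂ → p₁ = p₂) ∧
      (∀ q₁ q₂ : HFun X,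
        OrderConverges (fun n => ofContinuous (u₁ n * v₁ n)) q₁ →
        OrderConverges (fun n => ofContinuous (u₂ n * v₂ n)) q₂ → q₁ = q₂)) := by
  constructor
  · intro u v huf hvg
    have hu : JointlyCauchy u u := huf.jointlyCauchy huf
    have hv : JointlyCauchy v v := hvg.jointlyCauchy hvg
    exact ⟨(hu.add hv).existsUnique_orderConverges, (hu.mul hv).existsUnique_orderConverges⟩
  · intro u₁ u₂ v₁ v₂ hu₁ hu₂ hv₁ hv₂
    have hu : JointlyCauchy u₁ u₂ := hu₁.jointlyCauchy hu₂
    have hv : JointlyCauchy v₁ v₂ := hv₁.jointlyCauchy hv₂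
    exact ⟨fun _ _ => (hu.add hv).orderLimit_eq, fun _ _ => (hu.mul hv).orderLimit_eq⟩

theorem mainTheorem6 {d : ℕ} (Ω : Set (EuclideanSpace ℝ (Fin d))) (f g : HFun Ω) :
    (∀ u v : ℕ → C(Ω, ℝ), CauchyConverges u f → CauchyConverges v g →
      (∃! p : HFun Ω, OrderConverges (fun n => ofContinuous (u n + v n)) p) ∧
      (∃! q : HFun Ω, OrderConverges (fun n => ofContinuous (u n * v n)) q)) ∧
    (∀ u₁ u₂ v₁ v₂ : ℕ → C(Ω, ℝ),
      CauchyConverges u₁ f → CauchyConverges u₂ f →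
      CauchyConverges v₁ g → CauchyConverges v₂ g →
      (∀ p₁ p₂ : HFun Ω,
        OrderConverges (fun n => ofContinuous (u₁ n + v₁ n)) p₁ →
        OrderConverges (fun n => ofContinuous (u₂ n + v₂ n)) p₂ → p₁ = p₂) ∧
      (∀ q₁ q₂ : HFun Ω,
        OrderConverges (fun n => ofContinuous (u₁ n * v₁ n)) q₁ →
        OrderConverges (fun n => ofContinuous (u₂ n * v₂ n)) q₂ → q₁ = q₂)) :=
  mainTheorem6_general f g
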